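/- All graphs are finite unless stated otherwise. A graph $G=(V_G,E_G^{\mathrm{dir}},h_G,t_G,\iota_G)$ consists of a set $V_G$ of vertices, a set $E_G^{\mathrm{dir}}$ of directed edges, head and tail maps $h_G,t_G\colon E_G^{\mathrm{dir}}\to V_G$, and an involution $\iota_G$ of $E_G^{\mathrm{dir}}$ with $t_G\iota_G=h_G$ (so multiple edges, whole-loops $e\ne\iota_G e$ and half-loops $e=\iota_G e$ are allowed). The degree of a vertex $v$ is the number of directed edges $e$ with $h_G(e)=v$. The $(v,w)$ entry of the adjacency matrix $A_G$ is the number of directed edges with tail $v$ and head $w$. The Hashimoto matrix $H_G$ is indexed by $E_G^{\mathrm{dir}}$; its $(e_1,e_2)$ entry is $1$ if $h_G(e_1)=t_G(e_2)$ and $\iota_G e_1\ne e_2$, and $0$ otherwise. Let $\mu_1(G)$ denote the Perron--Frobenius eigenvalue of $H_G$, i.e., its largest real eigenvalue (with $\mu_1(G)=0$ if $G$ has no edges). A morphism $G\to B$ is a pair of maps on vertices and on directed edges that commute with heads, tails and the involutions. It is a covering map if, for each $v\in V_G$, it maps the directed edges with head $v$ bijectively onto those whose head is the image of $v$, and likewise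 with tails; it has degree $n$ if moreover every vertex of $B$ has exactly $n$ preimages. A $B$-graph is a graph together with a morphism to $B$; morphisms of $B$-graphs respect the maps to $B$. For a covering map $\pi\colon G\to B$, the new spectrum $\mathrm{Spec}^{\mathrm{new}}_B(A_G)$ consists of the eigenvalues of $A_G$ acting on the space of functions $f\colon V_G\to\mathbb R$ whose sum over each fibre $\pi^{-1}(b)$, $b\in V_B$, is zero. **Lemma (Fundamental Subgraph Lemma).** Let $d\ge 3$ be an integer, $B$ a $d$-regular graph, and $\psi_{/B}$ a fixed $B$-graph with $\mu_1(\psi)>(d-1)^{1/2}$. Set $$\lambda=\mu_1(\psi)+\frac{d-1}{\mu_1(\psi)}.$$ Then for any $\epsilon>0$ there exists an $n_0$ such that if $\pi\colon G\to B$ is a covering map of degree at least $n_0$ for which the $B$-graph $G$ has a subgraph isomorphic, as a $B$-graph, to $\psi_{/B}$, then $\mathrm{Spec}^{\mathrm{new}}_B(A_G)$ contains an eigenvalue larger than $\lambda-\epsilon$. -/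

import Mathlib

/-- A graph with vertex set `V` and directed edge set `E`: maps `head` and `tail` from directed
edges to vertices, and an involution `inv` of the directed edges that exchanges heads and tails.
Multiple edges, whole-loops (`inv e ≠ e`, `head e = tail e`) and half-loops (`inv e = e`)
are allowed. -/
structure InvGraph (V E : Type*) where
  head : E → V
  tail : E → V
  inv : E → E
  inv_inv : ∀ e, inv (inv e) = e
  tail_inv : ∀ e, tail (inv e) = head e

namespace InvGraph

/-- The degree of a vertex: the number of directed edges whose head is the vertex. -/
noncomputable def degree {V E : Type*} (G : InvGraph V E) (v : V) : ℕ :=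
  Nat.card {e : E // G.head e = v}

/-- `G` is `d`-regular. -/
def IsRegular {V E : Type*} (G : InvGraph V E) (d : ℕ) : Prop :=
  ∀ v, G.degree v = d

/-- The adjacency matrix: the `(v, w)` entry is the number of directed edges from `v` to `w`. -/
noncomputable def adjMatrix {V E : Type*} (G : InvGraph V E) : Matrix V V ℝ :=
  Matrix.of fun v w => (Nat.card {e : E // G.tail e = v ∧ G.head e = w} : ℝ)

open Classical in
/-- The Hashimoto (non-backtracking) matrix: the `(e₁, e₂)` entry is `1` if `e₁, e₂` are the
directed edges of a non-backtracking walk of length two, and `0` otherwise. -/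
noncomputable def hashimoto {V E : Type*} (G : InvGraph V E) : Matrix E E ℝ :=
  Matrix.of fun e₁ e₂ => if G.head e₁ = G.tail e₂ ∧ G.inv e₁ ≠ e₂ then 1 else 0

/-- The Perron-Frobenius eigenvalue of the Hashimoto matrix of a finite graph: its largest real
eigenvalue (and `0` if the graph has no edges). -/
noncomputable def mu₁ {V E : Type*} [Fintype E] (G : InvGraph V E) : ℝ :=
  sSup {μ : ℝ | Module.End.HasEigenvalue G.hashimoto.mulVecLin μ}

/-- A morphism of graphs. -/
structure Hom {V E V' E' : Type*} (G : InvGraph V E) (H : InvGraph V' E') where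
  onV : V → V'
  onE : E → E'
  map_head : ∀ e, H.head (onE e) = onV (G.head e)
  map_tail : ∀ e, H.tail (onE e) = onV (G.tail e)
  map_inv : ∀ e, onE (G.inv e) = H.inv (onE e)

/-- A covering map: for each vertex `v`, the directed edges with head `v` are mapped bijectively to
those with head `π v`, and the same with tails. -/
def Hom.IsCovering {V E V' E' : Type*} {G : InvGraph V E} {H : InvGraph V' E'}
    (π : G.Hom H) : Prop :=
  ∀ v, Set.BijOn π.onE {e | G.head e = v} {e | H.head e = π.onV v} ∧
    Set.BijOn π.onE {e | G.tail e = v} {e | H.tail e = π.onV v}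

/-- `π` is a covering map of degree `n`: every vertex fibre has exactly `n` elements. -/
def Hom.IsCoveringOfDegree {V E V' E' : Type*} {G : InvGraph V E} {H : InvGraph V' E'}
    (π : G.Hom H) (n : ℕ) : Prop :=
  π.IsCovering ∧ ∀ b, Nat.card {v : V // π.onV v = b} = n

/-- For graphs `G` and `S` over `B` with structure maps `π` and `p`: the `B`-graph `G` has a
subgraph isomorphic, as a `B`-graph, to `S`; that is, there is an injective morphism `S → G` that
respects the maps to `B` (its image is the subgraph). -/
def Hom.ContainsSubgraph {VG EG VS ES VB EB : Type*} {G : InvGraph VG EG} {S : InvGraph VS ES}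
    {B : InvGraph VB EB} (π : G.Hom B) (p : S.Hom B) : Prop :=
  ∃ j : S.Hom G, Function.Injective j.onV ∧ Function.Injective j.onE ∧
    (∀ v, π.onV (j.onV v) = p.onV v) ∧ (∀ e, π.onE (j.onE e) = p.onE e)

open Classical in
/-- The new functions of `π : G → B`: functions on the vertices of `G` whose sum over every
vertex fibre of `π` is zero. -/
def Hom.newFunctions {V E V' E' : Type*} [Fintype V] {G : InvGraph V E} {B : InvGraph V' E'}
    (π : G.Hom B) : Submodule ℝ (V → ℝ) where
  carrier := {f | ∀ b, ∑ v with π.onV v = b, f v = 0}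
  zero_mem' := by intro b; simp
  add_mem' := by
    intro f g hf hg b
    simp only [Set.mem_ofPred_eq] at hf hg
    simp [Finset.sum_add_distrib, hf b, hg b]
  smul_mem' := by
    intro c f hf b
    simp only [Set.mem_ofPred_eq] at hf
    simp [← Finset.mul_sum, hf b]

/-- The new adjacency spectrum of `π : G → B` (as a set): the eigenvalues of the adjacency matrix
of `G` acting on the new functions. -/
def Hom.newSpectrum {V E V' E' : Type*} [Fintype V] {G : InvGraph V E} {B : InvGraph V' E'}
    (π : G.Hom B) : Set ℝ :=
  {ν | ∃ f ∈ π.newFunctions, f ≠ 0 ∧ G.adjMatrix.mulVec f = ν • f}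

end InvGraph

/-! Let `q = d - 1`. A Hashimoto eigenvector for `μ > 1` on ψ has tail sums `g` solving `μ A g = (μ²
- 1 + deg) g`, and `|g|` is a nonnegative subsolution. If regular trees were attached to ψ to make
it `d`-regular, the extension of `g` by `μ⁻ᵏ` at distance `k` would be a subsolution for `λ = μ +
q/μ`, square-summable because `μ² > q`.

In G the trees need not embed, so they are replaced by non-backtracking walks that start on ψ with
an edge outside ψ. If `N k` counts those with `k + 1` edges by endpoint, weighted by `g` at the
start, then `A (N (k+1)) = N (k+2) + q N k`, as in a tree. Truncated radial weights in place of
`μ⁻ᵏ` (`exists_radial_weights`) give a finite combination `f ≥ 0` with `A f ≥ (λ - δ/2) f`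
(`exists_subsolution`). Its total mass is at most a constant `C`, and its norm is at least that of
`g`, both independent of G.

Subtracting fibre averages makes `f` new and changes the quadratic form by at most `d C² / n`. For
large `n` the Rayleigh principle on the new functions yields the eigenvalue. -/

open Finset

/-! ### Rayleigh principle on an invariant subspace -/

/-- If a symmetric matrix preserves a subspace on which all its eigenvalues are at most `c`, then
its quadratic form on the subspace is at most `c` times the square of the norm. -/
theorem Matrix.IsSymm.dotProduct_mulVec_le_of_eigenvalues_le {V : Type*} [Fintype V]
    {M : Matrix V V ℝ} (hM : M.IsSymm) (W : Submodule ℝ (V → ℝ))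
    (hW : ∀ w ∈ W, M.mulVec w ∈ W) (c : ℝ)
    (hc : ∀ ν : ℝ, ∀ w ∈ W, w ≠ 0 → M.mulVec w = ν • w → ν ≤ c) {w : V → ℝ} (hw : w ∈ W) :
    w ⬝ᵥ M.mulVec w ≤ c * (w ⬝ᵥ w) := by
  classical
  let φ : EuclideanSpace ℝ V ≃ₗ[ℝ] (V → ℝ) := WithLp.linearEquiv 2 ℝ (V → ℝ)
  let W' : Submodule ℝ (EuclideanSpace ℝ V) := W.comap φ.toLinearMap
  let T : EuclideanSpace ℝ V →ₗ[ℝ] EuclideanSpace ℝ V := Matrix.toEuclideanLin M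
  have hTW : ∀ x ∈ W', T x ∈ W' := fun x hx => hW _ hx
  have hTsymm : T.IsSymmetric := by
    rw [Matrix.isSymmetric_toEuclideanLin_iff, Matrix.IsHermitian,
      Matrix.conjTranspose_eq_transpose_of_trivial]
    exact hM
  let S : W' →ₗ[ℝ] W' := T.restrict hTW
  have hS : S.IsSymmetric := hTsymm.restrict_invariant hTW
  -- Expand in an orthonormal eigenbasis of the restriction to `W`.
  have key : ∀ x : W', inner ℝ (S x) x ≤ c * ‖x‖ ^ 2 := by
    intro x
    have hev : ∀ i, hS.eigenvalues rfl i ≤ c := by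
      intro i
      have h := hS.hasEigenvector_eigenvectorBasis rfl i
      have h1 := h.apply_eq_smul
      refine hc _ (φ (hS.eigenvectorBasis rfl i : W')) (hS.eigenvectorBasis rfl i : W').2 ?_ ?_
      · intro h0
        refine h.2 (Subtype.ext ?_)
        simpa using h0
      · exact congrArg (fun z : W' => φ (z : EuclideanSpace ℝ V)) h1
    rw [← (hS.eigenvectorBasis rfl).sum_inner_mul_inner, ← real_inner_self_eq_norm_sq,
      ← (hS.eigenvectorBasis rfl).sum_inner_mul_inner, Finset.mul_sum]
    refine Finset.sum_le_sum fun i _ => ?_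
    have h1 : inner ℝ (S x) (hS.eigenvectorBasis rfl i)
        = hS.eigenvalues rfl i * inner ℝ x (hS.eigenvectorBasis rfl i) := by
      rw [hS, hS.apply_eigenvectorBasis]
      simp [inner_smul_right]
    rw [h1, real_inner_comm x, mul_assoc]
    exact mul_le_mul_of_nonneg_right (hev i) (mul_self_nonneg _)
  have h := key ⟨φ.symm w, by simpa [W'] using hw⟩
  rw [← real_inner_self_eq_norm_sq] at h
  have h2 : inner ℝ (T (φ.symm w)) (φ.symm w) ≤ c * inner ℝ (φ.symm w) (φ.symm w) := h
  rw [EuclideanSpace.inner_eq_star_dotProduct, EuclideanSpace.inner_eq_star_dotProduct] at h2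
  simpa [T, φ, Matrix.toLpLin_apply] using h2

namespace InvGraph

/-! ### Edge sums, non-backtracking steps and the Ihara–Bass equation -/

section EdgeSums

variable {V E : Type*} (G : InvGraph V E)

theorem head_inv (e : E) : G.head (G.inv e) = G.tail e := by
  rw [← G.tail_inv, G.inv_inv]

theorem adjMatrix_isSymm : G.adjMatrix.IsSymm := by
  ext v w
  simp only [Matrix.transpose_apply, adjMatrix, Matrix.of_apply]
  congr 1
  exact Nat.card_congr ⟨fun e => ⟨G.inv e, by simp [G.tail_inv, G.head_inv, e.2]⟩,
    fun e => ⟨G.inv e, by simp [G.tail_inv, G.head_inv, e.2]⟩,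
    fun e => by simp [G.inv_inv], fun e => by simp [G.inv_inv]⟩

variable [Fintype E]

open Classical in
/-- The sum of an edge function over the edges with a given head. -/
noncomputable def headSum (y : E → ℝ) (v : V) : ℝ := ∑ e with G.head e = v, y e

open Classical in
/-- The sum of an edge function over the edges with a given tail. -/
noncomputable def tailSum (y : E → ℝ) (v : V) : ℝ := ∑ e with G.tail e = v, y e

theorem headSum_nonneg {y : E → ℝ} (hy : ∀ e, 0 ≤ y e) (v : V) : 0 ≤ G.headSum y v :=
  Finset.sum_nonneg fun e _ => hy e

theorem tailSum_comp_inv (y : E → ℝ) (v : V) :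
    G.tailSum (fun e => y (G.inv e)) v = G.headSum y v := by
  classical
  refine Finset.sum_bij' (fun e _ => G.inv e) (fun e _ => G.inv e) ?_ ?_ ?_ ?_ ?_ <;>
    simp +contextual [G.inv_inv, G.tail_inv, G.head_inv]

theorem headSum_comp_inv (y : E → ℝ) (v : V) :
    G.headSum (fun e => y (G.inv e)) v = G.tailSum y v := by
  rw [← tailSum_comp_inv]
  simp [G.inv_inv]

theorem tailSum_comp_tail (y : V → ℝ) (v : V) :
    G.tailSum (fun e => y (G.tail e)) v = G.degree v * y v := by
  classical
  have h1 : G.tailSum (fun e => y (G.tail e)) v = G.tailSum (fun _ => y v) v :=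
    Finset.sum_congr rfl fun e he => congrArg y (Finset.mem_filter.1 he).2
  rw [h1, ← G.headSum_comp_inv, headSum, degree, Nat.card_eq_fintype_card, Fintype.card_subtype]
  simp

theorem sum_headSum [Fintype V] (y : E → ℝ) : ∑ v, G.headSum y v = ∑ e, y e := by
  classical
  exact Finset.sum_fiberwise _ _ _

theorem sum_tailSum [Fintype V] (y : E → ℝ) : ∑ v, G.tailSum y v = ∑ e, y e := by
  classical
  exact Finset.sum_fiberwise _ _ _

theorem adjMatrix_mulVec [Fintype V] (u : V → ℝ) :
    G.adjMatrix.mulVec u = G.tailSum (fun e => u (G.head e)) := by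
  classical
  ext v
  have h : ∀ w, (Nat.card {e : E // G.tail e = v ∧ G.head e = w} : ℝ) * u w
      = ∑ e ∈ (univ.filter fun e => G.tail e = v) with G.head e = w, u (G.head e) := by
    intro w
    rw [Finset.sum_congr rfl (g := fun _ => u w)
      fun e he => by rw [(Finset.mem_filter.1 he).2], Nat.card_eq_fintype_card,
      Fintype.card_subtype, Finset.filter_filter]
    simp
  simp only [Matrix.mulVec, dotProduct, adjMatrix, Matrix.of_apply, h]
  exact Finset.sum_fiberwise _ _ _

theorem adjMatrix_mulVec' [Fintype V] (u : V → ℝ) :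
    G.adjMatrix.mulVec u = G.headSum (fun e => u (G.tail e)) := by
  ext v
  rw [adjMatrix_mulVec, ← tailSum_comp_inv]
  simp [G.tail_inv]

/-- One step of the non-backtracking walk: the transpose of the Hashimoto matrix applied to an
edge function. -/
noncomputable def nbStep (y : E → ℝ) (e : E) : ℝ := G.headSum y (G.tail e) - y (G.inv e)

theorem nbStep_nonneg {y : E → ℝ} (hy : ∀ e, 0 ≤ y e) (e : E) : 0 ≤ G.nbStep y e := by
  classical
  refine sub_nonneg.2 (Finset.single_le_sum (f := y) (fun e _ => hy e) ?_)
  simp [G.head_inv]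

theorem nbStep_iterate_nonneg {y : E → ℝ} (hy : ∀ e, 0 ≤ y e) (k : ℕ) :
    ∀ e, 0 ≤ G.nbStep^[k] y e := by
  induction k with
  | zero => exact hy
  | succ k ih =>
    rw [Function.iterate_succ_apply']
    exact G.nbStep_nonneg ih

theorem headSum_sub (y z : E → ℝ) (v : V) :
    G.headSum (fun e => y e - z e) v = G.headSum y v - G.headSum z v :=
  Finset.sum_sub_distrib _ _

theorem tailSum_sub (y z : E → ℝ) (v : V) :
    G.tailSum (fun e => y e - z e) v = G.tailSum y v - G.tailSum z v :=
  Finset.sum_sub_distrib _ _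

/-- Each edge into `v` can be continued by every edge out of `v` except its own inverse. -/
theorem tailSum_nbStep (y : E → ℝ) (v : V) :
    G.tailSum (G.nbStep y) v = ((G.degree v : ℝ) - 1) * G.headSum y v := by
  have h := G.tailSum_sub (fun e => G.headSum y (G.tail e)) (fun e => y (G.inv e)) v
  rw [tailSum_comp_tail, tailSum_comp_inv] at h
  rw [sub_mul, one_mul]
  exact h

/-- One more step after a walk either does not backtrack or returns to the tail of its last edge. -/
theorem adjMatrix_mulVec_headSum [Fintype V] (y : E → ℝ) :
    G.adjMatrix.mulVec (G.headSum y) = G.headSum (G.nbStep y) + G.tailSum y := by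
  ext v
  have h := G.headSum_sub (fun e => G.headSum y (G.tail e)) (fun e => y (G.inv e)) v
  rw [G.headSum_comp_inv] at h
  rw [adjMatrix_mulVec', Pi.add_apply, ← sub_eq_iff_eq_add]
  exact h.symm

theorem sum_nbStep_iterate [Fintype V] {d : ℕ} (hG : G.IsRegular d) (y : E → ℝ) (k : ℕ) :
    ∑ e, G.nbStep^[k] y e = ((d : ℝ) - 1) ^ k * ∑ e, y e := by
  induction k with
  | zero => simp
  | succ k ih =>
    rw [Function.iterate_succ_apply', ← G.sum_tailSum]
    simp only [tailSum_nbStep, hG _]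
    rw [← Finset.mul_sum, sum_headSum, ih, pow_succ]
    ring

/-- A Hashimoto eigenvector yields a vertex function solving the Ihara-Bass equation. -/
theorem exists_iharaBass_of_hasEigenvalue [Fintype V] {μ : ℝ} (hμ : 1 < μ)
    (h : Module.End.HasEigenvalue G.hashimoto.mulVecLin μ) :
    ∃ g : V → ℝ, g ≠ 0 ∧
      ∀ v, μ * G.adjMatrix.mulVec g v = (μ ^ 2 - 1 + G.degree v) * g v := by
  classical
  obtain ⟨x, hx⟩ := h.exists_hasEigenvector
  have hx1 : G.hashimoto.mulVec x = μ • x := by simpa using hx.apply_eq_smul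
  have h1 : ∀ e, x (G.inv e) + μ * x e = G.tailSum x (G.head e) := by
    intro e
    have h2 : G.hashimoto.mulVec x e = μ * x e := by rw [hx1]; rfl
    rw [← h2]
    simp only [Matrix.mulVec, dotProduct, hashimoto, Matrix.of_apply, ite_mul, one_mul, zero_mul]
    rw [← Finset.sum_filter, tailSum]
    have h3 : G.inv e ∈ univ.filter fun e' => G.tail e' = G.head e := by simp [G.tail_inv]
    rw [← Finset.add_sum_erase _ _ h3]
    congr 1
    refine Finset.sum_congr ?_ fun _ _ => rfl
    ext e'
    simp only [mem_filter, mem_univ, true_and, mem_erase]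
    rw [and_comm, ne_comm, eq_comm (a := G.head e)]
  -- Eliminate `x (inv e)` between `h1` at `e` and at `inv e`. As `μ² ≠ 1`, the tail sums determine
  -- `x`, so they do not all vanish.
  have h2 : ∀ e, (μ ^ 2 - 1) * x e + G.tailSum x (G.tail e) = μ * G.tailSum x (G.head e) := by
    intro e
    have h3 := h1 (G.inv e)
    rw [G.inv_inv, G.head_inv] at h3
    rw [← h3, ← h1]
    ring
  refine ⟨G.tailSum x, ?_, fun v => ?_⟩
  · intro h0
    apply hx.2
    ext e
    have h3 := h2 e
    simp only [h0, Pi.zero_apply, mul_zero, add_zero] at h3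
    have h4 : μ ^ 2 - 1 ≠ 0 := by nlinarith
    simpa [h4] using h3
  · rw [adjMatrix_mulVec]
    have h3 : μ * G.tailSum (fun e => G.tailSum x (G.head e)) v
        = (μ ^ 2 - 1) * G.tailSum x v + G.tailSum (fun e => G.tailSum x (G.tail e)) v := by
      simp only [tailSum, Finset.mul_sum, ← Finset.sum_add_distrib]
      refine Finset.sum_congr rfl fun e _ => ?_
      have := h2 e
      simp only [tailSum] at this
      rw [← Finset.mul_sum, ← this]
    rw [h3, tailSum_comp_tail]
    ring

/-- The absolute value of a solution of the Ihara-Bass equation is a subsolution. -/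
theorem exists_nonneg_iharaBass_of_hasEigenvalue [Fintype V] {μ : ℝ} (hμ : 1 < μ)
    (h : Module.End.HasEigenvalue G.hashimoto.mulVecLin μ) :
    ∃ g : V → ℝ, (∀ v, 0 ≤ g v) ∧ 0 < ∑ v, g v ^ 2 ∧
      ∀ v, (μ ^ 2 - 1 + G.degree v) * g v ≤ μ * G.adjMatrix.mulVec g v := by
  obtain ⟨g, hg0, hg⟩ := G.exists_iharaBass_of_hasEigenvalue hμ h
  refine ⟨fun v => |g v|, fun v => abs_nonneg _, ?_, fun v => ?_⟩
  · obtain ⟨v, hv⟩ := Function.ne_iff.1 hg0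
    refine Finset.sum_pos' (fun v _ => sq_nonneg _) ⟨v, mem_univ v, ?_⟩
    have : 0 < |g v| := abs_pos.2 hv
    positivity
  · have h1 : 0 ≤ μ ^ 2 - 1 + G.degree v := by
      have : (0 : ℝ) ≤ G.degree v := Nat.cast_nonneg _
      nlinarith
    rw [← abs_of_nonneg h1, ← abs_mul, ← hg v, abs_mul, abs_of_pos (by linarith : 0 < μ)]
    refine mul_le_mul_of_nonneg_left ?_ (by linarith)
    simp only [adjMatrix_mulVec]
    exact Finset.abs_sum_le_sum_abs _ _

/-- Positivity rules out the default value `sSup ∅ = 0`; a finite nonempty set attains its supremum.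
-/
theorem hasEigenvalue_mu₁ (h : 0 < G.mu₁) :
    Module.End.HasEigenvalue G.hashimoto.mulVecLin G.mu₁ := by
  classical
  have hfin : {μ : ℝ | Module.End.HasEigenvalue G.hashimoto.mulVecLin μ}.Finite :=
    Module.End.finite_hasEigenvalue _
  have hne : {μ : ℝ | Module.End.HasEigenvalue G.hashimoto.mulVecLin μ}.Nonempty := by
    by_contra h0
    rw [Set.not_nonempty_iff_eq_empty] at h0
    rw [mu₁, h0, Real.sSup_empty] at h
    exact h.false
  exact hne.csSup_mem hfin

end EdgeSums

end InvGraph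


/-! ### Truncated radial weights -/

/-- Compactly supported nonnegative radial weights which satisfy the radial eigenvalue inequality
on a tree, with a loss of `ε`. -/
theorem exists_radial_weights {q μ ε : ℝ} (hq : 0 < q) (hμ0 : 0 < μ) (hμ : q < μ ^ 2)
    (hε : 0 < ε) :
    ∃ (a : ℕ → ℝ) (R : ℕ), a 0 = 1 ∧ a 1 = 1 / μ ∧ (∀ k, 0 ≤ a k) ∧ a (R + 2) = 0 ∧
      ∀ k, (μ + q / μ - ε) * a (k + 1) ≤ a k + q * a (k + 2) := by
  set δ := ε / q with hδ
  have hδ0 : 0 < δ := div_pos hε hq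
  have hqδ : q * δ = ε := by rw [hδ]; field_simp
  -- The ratios `a (j+1) / a j` start at the ideal `1/μ` and fall linearly to 0; a drop of `δ = ε/q`
  -- per step costs at most `ε`.
  let r : ℕ → ℝ := fun j => max 0 (1 / μ - j * δ)
  have hr : ∀ j, 0 ≤ r j := fun j => le_max_left _ _
  obtain ⟨R, hR⟩ := exists_nat_gt (1 / μ / δ)
  rw [div_lt_iff₀ hδ0] at hR
  refine ⟨fun k => ∏ j ∈ range k, r j, R, by simp, ?_, fun k => prod_nonneg fun j _ => hr j, ?_,
    fun k => ?_⟩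
  · have : (0 : ℝ) ≤ μ⁻¹ := by positivity
    simp [r, this]
  · refine prod_eq_zero (mem_range.2 (Nat.lt_succ_self (R + 1))) (max_eq_left ?_)
    push_cast
    nlinarith
  · have hs : r k - δ ≤ r (k + 1) ∨ r k = 0 := by
      rcases max_choice (0 : ℝ) (1 / μ - k * δ) with h | h
      · exact Or.inr h
      · left
        refine le_trans (le_of_eq ?_) (le_max_right _ _)
        simp only [r, h]
        push_cast
        ring
    have hr1 : r k ≤ 1 / μ := by
      refine max_le (by positivity) ?_
      have : 0 ≤ (k : ℝ) * δ := by positivity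
      linarith
    -- The desired inequality divided by `a k`. It follows from `(1 - μ r)(1 - (q/μ) r) ≥ 0`, valid
    -- for `0 ≤ r ≤ 1/μ` because `q < μ²`.
    have key : (μ + q / μ - ε) * r k ≤ 1 + q * (r k * r (k + 1)) := by
      rcases hs with hs | hs
      · have h1 : 0 ≤ 1 - μ * r k := by
          rw [le_div_iff₀ hμ0] at hr1
          linarith
        have h2 : 0 ≤ 1 - q / μ * r k := by
          have h3 : q / μ * r k ≤ μ * r k := by
            refine mul_le_mul_of_nonneg_right ?_ (hr k)
            rw [div_le_iff₀ hμ0]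
            nlinarith
          linarith
        have h3 := mul_nonneg h1 h2
        have h4 : μ * (q / μ) = q := by field_simp
        have h5 : q * (r k * (r k - δ)) ≤ q * (r k * r (k + 1)) :=
          mul_le_mul_of_nonneg_left (mul_le_mul_of_nonneg_left hs (hr k)) hq.le
        have h6 : (1 - μ * r k) * (1 - q / μ * r k)
            = 1 - (μ + q / μ) * r k + (μ * (q / μ)) * r k ^ 2 := by ring
        rw [h6, h4] at h3
        have h7 : q * (r k * (r k - δ)) = q * r k ^ 2 - (q * δ) * r k := by ring
        rw [h7, hqδ] at h5
        linarith
      · simp [hs]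
    have h0 : 0 ≤ ∏ j ∈ range k, r j := prod_nonneg fun j _ => hr j
    have h1 := mul_le_mul_of_nonneg_left key h0
    simp only [prod_range_succ]
    linarith

theorem Finset.sum_filter_extend {α β : Type*} [Fintype α] [Fintype β] {k : α → β}
    (hk : Function.Injective k) (y : α → ℝ) (P : β → Prop) [DecidablePred P] :
    ∑ e with P e, Function.extend k y (0 : β → ℝ) e = ∑ e with P (k e), y e := by
  symm
  refine Finset.sum_of_injOn k hk.injOn (fun e => by simp) ?_
    fun e _ => (hk.extend_apply y 0 e).symm
  intro e he h
  refine Function.extend_apply' y (0 : β → ℝ) e ?_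
  rintro ⟨e', rfl⟩
  exact h ⟨e', by simpa using he, rfl⟩

/-! ### The test function grown from a subgraph -/

namespace InvGraph

section Subgraph

variable {VG EG VS ES : Type*} [Fintype EG] [Fintype ES] {G : InvGraph VG EG}
  {S : InvGraph VS ES} {j : S.Hom G}

theorem headSum_extend (hV : Function.Injective j.onV) (hE : Function.Injective j.onE)
    (y : ES → ℝ) :
    G.headSum (Function.extend j.onE y 0) = Function.extend j.onV (S.headSum y) 0 := by
  classical
  ext v
  rw [headSum, Finset.sum_filter_extend hE]
  simp only [j.map_head]
  by_cases hv : ∃ u, j.onV u = v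
  · obtain ⟨u, rfl⟩ := hv
    simp [hV.extend_apply, hV.eq_iff, headSum]
  · rw [Function.extend_apply' _ _ _ hv]
    refine Finset.sum_eq_zero fun e he => ?_
    exact absurd ⟨_, (Finset.mem_filter.1 he).2⟩ hv

theorem tailSum_extend (hV : Function.Injective j.onV) (hE : Function.Injective j.onE)
    (y : ES → ℝ) :
    G.tailSum (Function.extend j.onE y 0) = Function.extend j.onV (S.tailSum y) 0 := by
  classical
  ext v
  rw [tailSum, Finset.sum_filter_extend hE]
  simp only [j.map_tail]
  by_cases hv : ∃ u, j.onV u = v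
  · obtain ⟨u, rfl⟩ := hv
    simp [hV.extend_apply, hV.eq_iff, tailSum]
  · rw [Function.extend_apply' _ _ _ hv]
    refine Finset.sum_eq_zero fun e he => ?_
    exact absurd ⟨_, (Finset.mem_filter.1 he).2⟩ hv

/-- A compactly supported approximate subsolution of the eigenvalue equation of a regular graph
`G`, built from a subsolution of the Ihara-Bass equation on a subgraph and from radial weights. -/
theorem exists_subsolution [Fintype VG] [Fintype VS] {d : ℕ} (hd : 1 ≤ d) (hG : G.IsRegular d)
    (hV : Function.Injective j.onV) (hE : Function.Injective j.onE) {μ c : ℝ} (hμ : 0 < μ)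
    (hc : c ≤ μ + ((d : ℝ) - 1) / μ) {g : VS → ℝ} (hg : ∀ v, 0 ≤ g v)
    (hgA : ∀ v, (μ ^ 2 - 1 + S.degree v) * g v ≤ μ * S.adjMatrix.mulVec g v)
    {a : ℕ → ℝ} {R : ℕ} (ha0 : a 0 = 1) (ha1 : a 1 = 1 / μ) (ha : ∀ k, 0 ≤ a k)
    (haR : a (R + 2) = 0) (hac : ∀ k, c * a (k + 1) ≤ a k + ((d : ℝ) - 1) * a (k + 2)) :
    ∃ f : VG → ℝ, (∀ v, 0 ≤ f v) ∧ (∀ v, c * f v ≤ G.adjMatrix.mulVec f v) ∧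
      ∑ v, g v ^ 2 ≤ ∑ v, f v ^ 2 ∧
      ∑ v, f v ≤ (1 + ∑ k ∈ range (R + 1), a (k + 1) * (((d : ℝ) - 1) ^ k * d)) * ∑ v, g v := by
  classical
  have hd1 : (0 : ℝ) ≤ (d : ℝ) - 1 := by
    have : (1 : ℝ) ≤ d := by exact_mod_cast hd
    linarith
  set g' : VG → ℝ := Function.extend j.onV g 0 with hg'
  have hg'0 : ∀ v, 0 ≤ g' v := by
    intro v
    by_cases hv : ∃ u, j.onV u = v
    · obtain ⟨u, rfl⟩ := hv
      rw [hg', hV.extend_apply]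
      exact hg u
    · rw [hg', Function.extend_apply' _ _ _ hv]
      rfl
  set z : EG → ℝ := Function.extend j.onE (fun e => g (S.tail e)) 0 with hz
  -- Vanishes on the edges of the subgraph: it weights the first edges of walks leaving ψ by `g` at
  -- their tails.
  set y : EG → ℝ := fun e => g' (G.tail e) - z e with hy
  have hzle : ∀ e, 0 ≤ z e ∧ z e ≤ g' (G.tail e) := by
    intro e
    by_cases he : ∃ e', j.onE e' = e
    · obtain ⟨e', rfl⟩ := he
      rw [hz, hE.extend_apply, j.map_tail, hg', hV.extend_apply]
      exact ⟨hg _, le_rfl⟩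
    · rw [hz, Function.extend_apply' _ _ _ he]
      exact ⟨le_rfl, hg'0 _⟩
  have hy0 : ∀ e, 0 ≤ y e := fun e => sub_nonneg.2 (hzle e).2
  set N : ℕ → VG → ℝ := fun k => G.headSum (G.nbStep^[k] y) with hN
  have hN0 : ∀ k v, 0 ≤ N k v := fun k => G.headSum_nonneg (G.nbStep_iterate_nonneg hy0 k)
  have hsumg' : ∑ v, g' v = ∑ v, g v := by
    have := Finset.sum_filter_extend hV g (fun _ => True)
    simpa using this
  have hsumg2 : ∑ v, g' v ^ 2 = ∑ v, g v ^ 2 := by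
    symm
    refine Finset.sum_of_injOn j.onV hV.injOn (fun e => by simp) ?_ ?_
    · intro v _ hv
      rw [hg', Function.extend_apply' _ _ _ (fun ⟨u, hu⟩ => hv ⟨u, by simp, hu⟩)]
      simp
    · intro u _
      rw [hg', hV.extend_apply]
  have hsumN : ∀ k, ∑ v, N k v ≤ ((d : ℝ) - 1) ^ k * d * ∑ v, g v := by
    intro k
    rw [hN, G.sum_headSum, G.sum_nbStep_iterate hG, mul_assoc]
    refine mul_le_mul_of_nonneg_left ?_ (pow_nonneg hd1 k)
    have h1 : ∑ e, g' (G.tail e) = d * ∑ v, g v := by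
      rw [← G.sum_tailSum, ← hsumg', Finset.mul_sum]
      simp only [tailSum_comp_tail, hG _]
    rw [← h1]
    exact Finset.sum_le_sum fun e _ => sub_le_self _ (hzle e).1
  have hAg' : ∀ v, G.adjMatrix.mulVec g' v
      = N 0 v + Function.extend j.onV (S.adjMatrix.mulVec g) 0 v := by
    intro v
    rw [S.adjMatrix_mulVec', ← headSum_extend hV hE, adjMatrix_mulVec']
    have := G.headSum_sub (fun e => g' (G.tail e)) z v
    simp only [hN, Function.iterate_zero, id_eq]
    rw [hy, this]
    ring
  have hty : ∀ v, G.tailSum y v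
      = Function.extend j.onV (fun u => ((d : ℝ) - S.degree u) * g u) 0 v := by
    intro v
    rw [hy, G.tailSum_sub, tailSum_comp_tail, hG, hz, tailSum_extend hV hE]
    by_cases hv : ∃ u, j.onV u = v
    · obtain ⟨u, rfl⟩ := hv
      rw [hg', hV.extend_apply, hV.extend_apply, hV.extend_apply, tailSum_comp_tail]
      ring
    · rw [hg', Function.extend_apply' _ _ _ hv, Function.extend_apply' _ _ _ hv,
        Function.extend_apply' _ _ _ hv]
      simp
  -- At a vertex of ψ the `d - deg` missing edges each contribute `g/μ`, turning the Ihara–Bass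
  -- factor `(μ² - 1 + deg)/μ` into exactly `μ + (d-1)/μ`.
  have hroot : ∀ v, c * g' v
      ≤ Function.extend j.onV (S.adjMatrix.mulVec g) 0 v + a 1 * G.tailSum y v := by
    intro v
    rw [hty]
    by_cases hv : ∃ u, j.onV u = v
    · obtain ⟨u, rfl⟩ := hv
      rw [hg', hV.extend_apply, hV.extend_apply, hV.extend_apply, ha1]
      refine (mul_le_mul_of_nonneg_right hc (hg u)).trans ?_
      have h1 := div_le_div_of_nonneg_right (hgA u) hμ.le
      rw [mul_div_cancel_left₀ _ hμ.ne'] at h1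
      have h2 : (μ + ((d : ℝ) - 1) / μ) * g u
          = (μ ^ 2 - 1 + S.degree u) * g u / μ + 1 / μ * (((d : ℝ) - S.degree u) * g u) := by
        field_simp
        ring
      linarith
    · rw [hg', Function.extend_apply' _ _ _ hv, Function.extend_apply' _ _ _ hv,
        Function.extend_apply' _ _ _ hv]
      simp
  have hAN : ∀ k, G.adjMatrix.mulVec (N k) = N (k + 1) + G.tailSum (G.nbStep^[k] y) := by
    intro k
    simp only [hN, adjMatrix_mulVec_headSum, Function.iterate_succ_apply']
  have htN : ∀ k v, G.tailSum (G.nbStep^[k + 1] y) v = ((d : ℝ) - 1) * N k v := by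
    intro k v
    rw [Function.iterate_succ_apply', tailSum_nbStep, hG]
  let F : ℕ → VG → ℝ := fun m => g' + ∑ k ∈ range m, a (k + 1) • N k
  have hFv : ∀ m v, F m v = g' v + ∑ k ∈ range m, a (k + 1) * N k v := by
    intro m v
    simp [F, Finset.sum_apply]
  have hFsucc : ∀ m, F (m + 1) = F m + a (m + 1) • N m := by
    intro m
    simp only [F, Finset.sum_range_succ, add_assoc]
  have hAF : ∀ m v, G.adjMatrix.mulVec (F (m + 1)) v
      = Function.extend j.onV (S.adjMatrix.mulVec g) 0 v + a 1 * G.tailSum y v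
        + ∑ k ∈ range (m + 2), a k * N k v
        + ((d : ℝ) - 1) * ∑ k ∈ range m, a (k + 2) * N k v := by
    intro m v
    induction m with
    | zero =>
      rw [hFsucc, Matrix.mulVec_add, Matrix.mulVec_smul, hAN]
      simp only [F, Finset.sum_range_zero, add_zero, Pi.add_apply, Pi.smul_apply, smul_eq_mul,
        hAg', Function.iterate_zero, id_eq, Finset.sum_range_succ, ha0]
      ring
    | succ m ih =>
      rw [hFsucc, Matrix.mulVec_add, Matrix.mulVec_smul, hAN, Pi.add_apply, ih,
        Pi.smul_apply, Pi.add_apply, htN, Finset.sum_range_succ _ (m + 2),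
        Finset.sum_range_succ _ m, smul_eq_mul]
      ring
  have hFge : ∀ v, g' v ≤ F (R + 1) v := by
    intro v
    rw [hFv]
    exact le_add_of_nonneg_right
      (Finset.sum_nonneg fun k _ => mul_nonneg (ha _) (hN0 _ _))
  refine ⟨F (R + 1), fun v => (hg'0 v).trans (hFge v), fun v => ?_, ?_, ?_⟩
  · rw [hAF, hFv]
    have h1 : ∑ k ∈ range (R + 1), a k * N k v ≤ ∑ k ∈ range (R + 2), a k * N k v := by
      rw [Finset.sum_range_succ _ (R + 1)]
      exact le_add_of_nonneg_right (mul_nonneg (ha _) (hN0 _ _))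
    -- Here `a (R + 2) = 0` closes the truncation: the radial inequality holds up to the last layer.
    have h2 : ∑ k ∈ range R, a (k + 2) * N k v = ∑ k ∈ range (R + 1), a (k + 2) * N k v := by
      rw [Finset.sum_range_succ _ R, haR, zero_mul, add_zero]
    have h3 : c * ∑ k ∈ range (R + 1), a (k + 1) * N k v
        ≤ ∑ k ∈ range (R + 1), a k * N k v
          + ((d : ℝ) - 1) * ∑ k ∈ range (R + 1), a (k + 2) * N k v := by
      rw [Finset.mul_sum, Finset.mul_sum, ← Finset.sum_add_distrib]
      refine Finset.sum_le_sum fun k _ => ?_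
      have := mul_le_mul_of_nonneg_right (hac k) (hN0 k v)
      linarith
    rw [h2, mul_add]
    linarith [hroot v]
  · rw [← hsumg2]
    exact Finset.sum_le_sum fun v _ => pow_le_pow_left₀ (hg'0 v) (hFge v) 2
  · simp only [hFv]
    rw [Finset.sum_add_distrib, hsumg', Finset.sum_comm, add_mul, one_mul, Finset.sum_mul]
    refine add_le_add_right (Finset.sum_le_sum fun k _ => ?_) _
    rw [← Finset.mul_sum, mul_assoc]
    exact mul_le_mul_of_nonneg_left (hsumN k) (ha _)

end Subgraph

/-! ### Coverings, new functions and the loss from old functions -/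

section Covering

variable {VG EG VB EB : Type*} {G : InvGraph VG EG} {B : InvGraph VB EB} {π : G.Hom B}

theorem Hom.IsCovering.degree_eq (hπ : π.IsCovering) (v : VG) :
    G.degree v = B.degree (π.onV v) :=
  Nat.card_congr ((hπ v).1.equiv _)

theorem Hom.IsCovering.adjMatrix_mulVec_comp [Fintype VG] [Fintype EG] [Fintype VB] [Fintype EB]
    (hπ : π.IsCovering) (β : VB → ℝ) :
    G.adjMatrix.mulVec (β ∘ π.onV) = B.adjMatrix.mulVec β ∘ π.onV := by
  classical
  ext v
  rw [Function.comp_apply, adjMatrix_mulVec, adjMatrix_mulVec, tailSum, tailSum]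
  have h := (hπ v).2
  refine Finset.sum_nbij π.onE ?_ ?_ ?_ ?_
  · intro e he
    simpa using h.mapsTo (by simpa using he)
  · simpa [Set.InjOn] using h.injOn
  · simpa [Set.SurjOn, Set.subset_def] using h.surjOn
  · intro e _
    simp [π.map_head]

theorem Hom.dotProduct_comp_eq_zero [Fintype VG] [Fintype VB] {w : VG → ℝ}
    (hw : w ∈ π.newFunctions) (β : VB → ℝ) : w ⬝ᵥ (β ∘ π.onV) = 0 := by
  classical
  rw [dotProduct, ← Finset.sum_fiberwise univ π.onV]
  refine Finset.sum_eq_zero fun b _ => ?_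
  have h : ∑ v with π.onV v = b, w v = 0 := by
    have := hw b
    convert this
  rw [← zero_mul (β b), ← h, Finset.sum_mul]
  refine Finset.sum_congr rfl fun v hv => ?_
  rw [Function.comp_apply, (Finset.mem_filter.1 hv).2]

/-- New functions are orthogonal to pullbacks from B; the adjacency matrix is symmetric and
preserves pullbacks. Pulled-back indicators recover the fibre sums. -/
theorem Hom.IsCovering.mulVec_mem_newFunctions [Fintype VG] [Fintype EG] [Fintype VB] [Fintype EB]
    (hπ : π.IsCovering) {w : VG → ℝ} (hw : w ∈ π.newFunctions) :
    G.adjMatrix.mulVec w ∈ π.newFunctions := by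
  classical
  intro b
  have h : G.adjMatrix.mulVec w ⬝ᵥ (Pi.single b 1 ∘ π.onV) = 0 := by
    rw [dotProduct_comm, Matrix.dotProduct_mulVec, ← Matrix.mulVec_transpose,
      G.adjMatrix_isSymm.eq, hπ.adjMatrix_mulVec_comp, dotProduct_comm]
    exact Hom.dotProduct_comp_eq_zero hw _
  rw [← h, dotProduct, Finset.sum_filter]
  refine Finset.sum_congr rfl fun v _ => ?_
  simp [Pi.single_apply]

/-- If all new eigenvalues of a covering of degree `n` are at most `c`, then the adjacency form of
a nonnegative function exceeds `c` times the squared norm by at most `d / n` times the squared sum. -/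
theorem Hom.IsCoveringOfDegree.dotProduct_mulVec_le [Fintype VG] [Fintype EG] [Fintype VB]
    [Fintype EB] {n d : ℕ} (hn : 0 < n) (hπ : π.IsCoveringOfDegree n) (hG : G.IsRegular d)
    {c : ℝ} (hc0 : 0 ≤ c) (hc : ∀ ν ∈ π.newSpectrum, ν ≤ c) {f : VG → ℝ} (hf : ∀ v, 0 ≤ f v) :
    f ⬝ᵥ G.adjMatrix.mulVec f ≤ c * (f ⬝ᵥ f) + d * (∑ v, f v) ^ 2 / n := by
  classical
  have hn' : (0 : ℝ) < n := by exact_mod_cast hn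
  -- Fibre averages: `h` is the old part of `f`, with the same total sum but pointwise at most that
  -- sum over `n`.
  let β : VB → ℝ := fun b => (∑ v with π.onV v = b, f v) / n
  let h : VG → ℝ := β ∘ π.onV
  let w : VG → ℝ := f - h
  have hfib : ∀ b, ∑ v with π.onV v = b, h v = ∑ v with π.onV v = b, f v := by
    intro b
    have h1 : ∀ v ∈ univ.filter (fun v => π.onV v = b), h v = β b := fun v hv =>
      congrArg β (Finset.mem_filter.1 hv).2
    have h2 := hπ.2 b
    rw [Nat.card_eq_fintype_card, Fintype.card_subtype] at h2
    rw [Finset.sum_congr rfl h1, Finset.sum_const, h2, nsmul_eq_mul]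
    simp only [β]
    field_simp
  have hw : w ∈ π.newFunctions := by
    intro b
    have h1 : ∑ v with π.onV v = b, w v = 0 := by
      simp only [w, Pi.sub_apply, Finset.sum_sub_distrib, hfib, sub_self]
    convert h1
  have hsum : ∑ v, h v = ∑ v, f v := by
    rw [← Finset.sum_fiberwise univ π.onV h, ← Finset.sum_fiberwise univ π.onV f]
    exact Finset.sum_congr rfl fun b _ => hfib b
  have hh0 : ∀ v, 0 ≤ h v := fun v =>
    div_nonneg (Finset.sum_nonneg fun v _ => hf v) hn'.le
  have hhle : ∀ v, h v ≤ (∑ v, f v) / n := fun v =>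
    div_le_div_of_nonneg_right
      (Finset.sum_le_sum_of_subset_of_nonneg (Finset.filter_subset _ _) fun v _ _ => hf v) hn'.le
  have hAh : ∀ v, G.adjMatrix.mulVec h v ≤ d * ((∑ v, f v) / n) := by
    intro v
    rw [adjMatrix_mulVec']
    refine (Finset.sum_le_sum (g := fun _ => (∑ v, f v) / n) fun e _ => hhle _).trans ?_
    have h1 := hG v
    rw [degree, Nat.card_eq_fintype_card, Fintype.card_subtype] at h1
    rw [Finset.sum_const, h1, nsmul_eq_mul]
  have hhh : h ⬝ᵥ G.adjMatrix.mulVec h ≤ d * (∑ v, f v) ^ 2 / n := by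
    refine (Finset.sum_le_sum fun v _ => mul_le_mul_of_nonneg_left (hAh v) (hh0 v)).trans ?_
    rw [← Finset.sum_mul, hsum]
    apply le_of_eq
    ring
  have hfw : f = w + h := by simp [w]
  have hwh : w ⬝ᵥ h = 0 := Hom.dotProduct_comp_eq_zero hw β
  have hwAh : w ⬝ᵥ G.adjMatrix.mulVec h = 0 := by
    rw [hπ.1.adjMatrix_mulVec_comp]
    exact Hom.dotProduct_comp_eq_zero hw _
  have hhAw : h ⬝ᵥ G.adjMatrix.mulVec w = 0 := by
    rw [dotProduct_comm]
    exact Hom.dotProduct_comp_eq_zero (hπ.1.mulVec_mem_newFunctions hw) β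
  have hww : w ⬝ᵥ G.adjMatrix.mulVec w ≤ c * (w ⬝ᵥ w) :=
    G.adjMatrix_isSymm.dotProduct_mulVec_le_of_eigenvalues_le π.newFunctions
      (fun w hw => hπ.1.mulVec_mem_newFunctions hw) c
      (fun ν w hw hw0 hν => hc ν ⟨w, hw, hw0, hν⟩) hw
  have hff : w ⬝ᵥ w ≤ f ⬝ᵥ f := by
    rw [hfw, add_dotProduct, dotProduct_add, dotProduct_add, dotProduct_comm h w, hwh]
    have : 0 ≤ h ⬝ᵥ h := Finset.sum_nonneg fun v _ => mul_self_nonneg _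
    linarith
  have hfA : f ⬝ᵥ G.adjMatrix.mulVec f
      = w ⬝ᵥ G.adjMatrix.mulVec w + h ⬝ᵥ G.adjMatrix.mulVec h := by
    conv_lhs => rw [hfw]
    rw [Matrix.mulVec_add, add_dotProduct, dotProduct_add, dotProduct_add, hwAh, hhAw]
    ring
  rw [hfA]
  exact add_le_add (hww.trans (mul_le_mul_of_nonneg_left hff hc0)) hhh

end Covering

end InvGraph

/-! ### Choice of constants and conclusion -/

theorem mainTheorem5 {VB EB Vψ Eψ : Type*} [Fintype VB] [Fintype EB] [Fintype Vψ] [Fintype Eψ]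
    (d : ℕ) (hd : 3 ≤ d) (B : InvGraph VB EB) (hB : B.IsRegular d)
    (ψ : InvGraph Vψ Eψ) (p : ψ.Hom B) (hψ : Real.sqrt ((d : ℝ) - 1) < ψ.mu₁)
    (ε : ℝ) (hε : 0 < ε) :
    ∃ n₀ : ℕ, ∀ n : ℕ, n₀ ≤ n →
      ∀ (VG EG : Type*) [Fintype VG] [Fintype EG] (G : InvGraph VG EG) (π : G.Hom B),
        π.IsCoveringOfDegree n → π.ContainsSubgraph p →
        ∃ ν ∈ π.newSpectrum, ψ.mu₁ + ((d : ℝ) - 1) / ψ.mu₁ - ε < ν := by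
  set μ := ψ.mu₁ with hμdef
  have hd3 : (3 : ℝ) ≤ d := by exact_mod_cast hd
  have hq : (0 : ℝ) < (d : ℝ) - 1 := by linarith
  have hμ0 : 0 < μ := (Real.sqrt_nonneg _).trans_lt hψ
  have hμ2 : (d : ℝ) - 1 < μ ^ 2 := (Real.sqrt_lt' hμ0).1 hψ
  have hμ1 : 1 < μ := by nlinarith
  obtain ⟨g, hg, hgpos, hgA⟩ :=
    ψ.exists_nonneg_iharaBass_of_hasEigenvalue hμ1 (ψ.hasEigenvalue_mu₁ hμ0)
  set lam := μ + ((d : ℝ) - 1) / μ with hlam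
  have hlam0 : 0 < lam := by positivity
  -- Capping by `lam` keeps `lam - δ ≥ 0`, needed for the comparison of norms. Half of `δ` pays for
  -- the truncation, half for the old part of `f`.
  set δ := min ε lam with hδ
  have hδ0 : 0 < δ := lt_min hε hlam0
  obtain ⟨a, R, ha0, ha1, ha, haR, hac⟩ := exists_radial_weights hq hμ0 hμ2 (half_pos hδ0)
  set C := (1 + ∑ k ∈ range (R + 1), a (k + 1) * (((d : ℝ) - 1) ^ k * d)) * ∑ v, g v with hC
  obtain ⟨n₀, hn₀⟩ := exists_nat_gt (d * C ^ 2 / (δ / 2 * ∑ v, g v ^ 2))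
  refine ⟨n₀ + 1, fun n hn VG EG _ _ G π hπ hsub => ?_⟩
  obtain ⟨j, hV, hE, -, -⟩ := hsub
  have hG : G.IsRegular d := fun v => (hπ.1.degree_eq v).trans (hB _)
  obtain ⟨f, hf, hfA, hf2, hfC⟩ := InvGraph.exists_subsolution (by lia) hG hV hE hμ0
    (c := lam - δ / 2) (by linarith) hg hgA ha0 ha1 ha haR hac
  by_contra! hcon
  have h1 := hπ.dotProduct_mulVec_le (by lia) hG (c := lam - δ)
    (by linarith [min_le_right ε lam])
    (fun ν hν => (hcon ν hν).trans (by linarith [min_le_left ε lam])) hf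
  have h2 : (lam - δ / 2) * (f ⬝ᵥ f) ≤ f ⬝ᵥ G.adjMatrix.mulVec f := by
    rw [dotProduct, dotProduct, Finset.mul_sum]
    refine Finset.sum_le_sum fun v _ => ?_
    have := mul_le_mul_of_nonneg_left (hfA v) (hf v)
    linarith
  have hff : f ⬝ᵥ f = ∑ v, f v ^ 2 := Finset.sum_congr rfl fun v _ => (sq _).symm
  have hn' : (n₀ : ℝ) < n := by exact_mod_cast (by lia : n₀ < n)
  have hn0 : (0 : ℝ) < n := n₀.cast_nonneg.trans_lt hn'
  have h3 : (∑ v, f v) ^ 2 ≤ C ^ 2 :=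
    pow_le_pow_left₀ (Finset.sum_nonneg fun v _ => hf v) hfC 2
  have h4 : d * C ^ 2 / n < δ / 2 * ∑ v, g v ^ 2 := by
    rw [div_lt_comm₀ hn0 (by positivity)]
    exact hn₀.trans hn'
  have h5 : d * (∑ v, f v) ^ 2 / n ≤ d * C ^ 2 / n := by gcongr
  have h6 : δ / 2 * ∑ v, g v ^ 2 ≤ δ / 2 * (f ⬝ᵥ f) := by
    rw [hff]
    gcongr
  linarith
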